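/- Let $D\ge 2$ be an integer, $X=\{0,1\}^D$, let $\partial(x,y)$ be the number of coordinates in which $x,y\in X$ differ (the distance in the hypercube $H(D,2)$), and let $X_e$ be the set of all $x\in X$ with $\sum_i x_i$ even. Let $\mathbb C^X$ be the complex vector space with basis $X$ and $\mathbb C^{X_e}$ its subspace spanned by $X_e$. Define $\mathbf A\in\mathrm{End}(\mathbb C^X)$ by $\mathbf A y=\sum_{z:\,\partial(y,z)=1} z$ and, for $x\in X$, $\mathbf A^*(x)\in\mathrm{End}(\mathbb C^X)$ by $\mathbf A^*(x)y=(D-2\partial(x,y))\,y$ for all $y\in X$. Let $U(\mathfrak{sl}_2)$ be the unital associative $\mathbb C$-algebra generated by $E,F,H$ subject to $[H,E]=2E$, $[H,F]=-2F$, $[E,F]=H$, with the $\mathbb Z$-grading $U(\mathfrak{sl}_2)=\bigoplus_{n\in\mathbb Z} U_n$ in which $E,F,H$ have degrees $1,-1,0$, and let $U(\mathfrak{sl}_2)_e=\bigoplus_{n\in\mathbb Z}U_{2n}$, a subalgebra. For $x\in X$ let $\rho(x):U(\mathfrak{sl}_2)\to\mathrm{End}(\mathbb C^X)$ be the algebra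 homomorphism with $$E\mapsto \tfrac{\mathbf A}{2}-\tfrac{[\mathbf A,\mathbf A^*(x)]}{4},\qquad F\mapsto \tfrac{\mathbf A}{2}+\tfrac{[\mathbf A,\mathbf A^*(x)]}{4},\qquad H\mapsto \mathbf A^*(x).$$ The subspace $\mathbb C^{X_e}$ is invariant under $\rho(x)(U(\mathfrak{sl}_2)_e)$; write $\mathbb C^{X_e}(x)$ for the resulting $U(\mathfrak{sl}_2)_e$-module. For $n\in\mathbb N$ let $L_n$ be the $U(\mathfrak{sl}_2)$-module with basis $v_0,\dots,v_n$ and $Ev_i=(n-i+1)v_{i-1}$, $Fv_i=(i+1)v_{i+1}$, $Hv_i=(n-2i)v_i$, where $v_{-1}=v_{n+1}=0$. For $\theta\in\mathbb C$ put $L_n(\theta)=\{v\in L_n: Hv=\theta v\}$, and define the $U(\mathfrak{sl}_2)_e$-submodules $$L_n^{(0)}=\bigoplus_{i\in\mathbb Z}L_n(n-4i)\quad(n\ge 0),\qquad L_n^{(1)}=\bigoplus_{i\in\mathbb Z}L_n(n-4i-2)\quad(n\ge 1).$$ Theorem. For each $x\in X_e$ the $U(\mathfrak{sl}_2)_e$-module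 $\mathbb C^{X_e}(x)$ is isomorphic to $$\bigoplus_{\substack{0\le k\le\lfloor D/2\rfloor\\ k\text{ even}}}\frac{D-2k+1}{D-k+1}\binom{D}{k}\cdot L_{D-2k}^{(0)}\ \oplus\ \bigoplus_{\substack{1\le k\le\lfloor (D-1)/2\rfloor\\ k\text{ odd}}}\frac{D-2k+1}{D-k+1}\binom{D}{k}\cdot L_{D-2k}^{(1)},$$ where $m\cdot V$ denotes the direct sum of $m$ copies of $V$. -/

import Mathlib

open scoped DirectSum

noncomputable section

namespace HalvedCube

/-! ### The algebra `U(sl₂)` by generators and relations, and its even subalgebra -/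

/-- The three generators of `U(sl₂)`. -/
inductive Gen : Type
  | E
  | F
  | H

/-- The defining relations `[H,E] = 2E`, `[H,F] = -2F`, `[E,F] = H`. -/
inductive Rel : FreeAlgebra ℂ Gen → FreeAlgebra ℂ Gen → Prop
  | HE : Rel (FreeAlgebra.ι ℂ Gen.H * FreeAlgebra.ι ℂ Gen.E
        - FreeAlgebra.ι ℂ Gen.E * FreeAlgebra.ι ℂ Gen.H)
      ((2 : ℂ) • FreeAlgebra.ι ℂ Gen.E)
  | HF : Rel (FreeAlgebra.ι ℂ Gen.H * FreeAlgebra.ι ℂ Gen.F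
        - FreeAlgebra.ι ℂ Gen.F * FreeAlgebra.ι ℂ Gen.H)
      ((-2 : ℂ) • FreeAlgebra.ι ℂ Gen.F)
  | EF : Rel (FreeAlgebra.ι ℂ Gen.E * FreeAlgebra.ι ℂ Gen.F
        - FreeAlgebra.ι ℂ Gen.F * FreeAlgebra.ι ℂ Gen.E)
      (FreeAlgebra.ι ℂ Gen.H)

/-- The universal enveloping algebra `U(sl₂)` over `ℂ`. -/
abbrev U : Type := RingQuot Rel

/-- The image in `U(sl₂)` of a generator. -/
def gen (g : Gen) : U := RingQuot.mkAlgHom ℂ Rel (FreeAlgebra.ι ℂ g)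

/-- The algebra homomorphism out of `U(sl₂)` given by three elements that satisfy the
defining relations. -/
def liftU {B : Type*} [Ring B] [Algebra ℂ B] (e f h : B)
    (hHE : h * e - e * h = (2 : ℂ) • e) (hHF : h * f - f * h = (-2 : ℂ) • f)
    (hEF : e * f - f * e = h) : U →ₐ[ℂ] B :=
  RingQuot.liftAlgHom ℂ
    ⟨FreeAlgebra.lift ℂ (fun g : Gen => match g with
      | Gen.E => e
      | Gen.F => f
      | Gen.H => h), by
      intro a b hab
      cases hab <;> simp [hHE, hHF, hEF]⟩

section lift
variable {B : Type*} [Ring B] [Algebra ℂ B] (e f h : B)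
    (hHE : h * e - e * h = (2 : ℂ) • e) (hHF : h * f - f * h = (-2 : ℂ) • f)
    (hEF : e * f - f * e = h)

theorem liftU_E : liftU e f h hHE hHF hEF (gen Gen.E) = e := by simp [liftU, gen]
theorem liftU_F : liftU e f h hHE hHF hEF (gen Gen.F) = f := by simp [liftU, gen]
theorem liftU_H : liftU e f h hHE hHF hEF (gen Gen.H) = h := by simp [liftU, gen]
end lift

theorem gen_HE : gen Gen.H * gen Gen.E - gen Gen.E * gen Gen.H = (2 : ℂ) • gen Gen.E := by
  simpa [gen] using RingQuot.mkAlgHom_rel ℂ Rel.HE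

theorem gen_HF : gen Gen.H * gen Gen.F - gen Gen.F * gen Gen.H = (-2 : ℂ) • gen Gen.F := by
  simpa [gen, -neg_smul, -smul_eq_mul] using (RingQuot.mkAlgHom_rel ℂ Rel.HF).trans (map_smul _ _ _)

/-- The degrees of `E, F, H` are `1, -1, 0`. -/
def deg : Gen → ℤ
  | Gen.E => 1
  | Gen.F => -1
  | Gen.H => 0

/-- The `n`-th homogeneous subspace `U_n` of `U(sl₂)`: the image of the degree `n` part of
the free algebra, i.e. the span of all words in `E, F, H` of total degree `n`. -/
def homog (n : ℤ) : Submodule ℂ U :=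
  Submodule.span ℂ {u | ∃ w : List Gen, (w.map deg).sum = n ∧ u = (w.map gen).prod}

theorem one_mem_homog : (1 : U) ∈ homog 0 :=
  Submodule.subset_span ⟨[], by simp, by simp⟩

theorem homog_mul (m n : ℤ) : homog m * homog n ≤ homog (m + n) := by
  rw [homog, homog, Submodule.span_mul_span]
  apply Submodule.span_le.2
  rintro _ ⟨_, ⟨w, hw, rfl⟩, _, ⟨w', hw', rfl⟩, rfl⟩
  exact Submodule.subset_span ⟨w ++ w', by simp [hw, hw'], by simp⟩

/-- The even subalgebra `U(sl₂)_e = ⨁ₙ U_{2n}` of `U(sl₂)`. -/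
def Ue : Subalgebra ℂ U :=
  (⨆ n : ℤ, homog (2 * n)).toSubalgebra
    (by
      have h := Submodule.mem_iSup_of_mem (p := fun n : ℤ => homog (2 * n)) 0
        (by simpa using one_mem_homog)
      exact h)
    (by
      intro a b ha hb
      have hab := Submodule.mul_mem_mul ha hb
      rw [Submodule.iSup_mul] at hab
      refine (iSup_le fun m => ?_ : _ ≤ ⨆ n : ℤ, homog (2 * n)) hab
      rw [Submodule.mul_iSup]
      refine iSup_le fun n => (homog_mul _ _).trans ?_
      rw [← mul_add]
      exact le_iSup (fun n : ℤ => homog (2 * n)) (m + n))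

section modules

variable {V : Type*} [AddCommGroup V] [Module ℂ V] [Module U V] [IsScalarTower ℂ U V]

theorem homog_smul_mem (P : ℤ → Submodule ℂ V)
    (hP : ∀ g k, ∀ v ∈ P k, gen g • v ∈ P (k + deg g)) (n k : ℤ) {u : U} (hu : u ∈ homog n)
    {v : V} (hv : v ∈ P k) : u • v ∈ P (k + n) := by
  induction hu using Submodule.span_induction with
  | mem u hu =>
    obtain ⟨w, rfl, rfl⟩ := hu
    induction w with
    | nil => simpa using hv
    | cons g w ih =>
      have := hP g _ _ ih
      simp only [List.map_cons, List.prod_cons, List.sum_cons, mul_smul]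
      convert this using 2
      ring
  | zero => simp
  | add a b _ _ ha hb => rw [add_smul]; exact add_mem ha hb
  | smul c a _ ha => rw [smul_assoc]; exact Submodule.smul_mem _ _ ha

theorem Ue_smul_mem (P : ℤ → Submodule ℂ V)
    (hP : ∀ g k, ∀ v ∈ P k, gen g • v ∈ P (k + deg g)) {Q : Submodule ℂ V} {k : ℤ}
    (hQ : ∀ n : ℤ, P (k + 2 * n) ≤ Q) {u : U} (hu : u ∈ Ue)
    {v : V} (hv : v ∈ P k) : u • v ∈ Q := by
  change u ∈ ⨆ n : ℤ, homog (2 * n) at hu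
  induction hu using Submodule.iSup_induction' with
  | mem n u hu => exact hQ n (homog_smul_mem P hP _ _ hu hv)
  | zero => simp
  | add a b _ _ ha hb => rw [add_smul]; exact add_mem ha hb

variable (V) in
/-- The weight space `V(θ) = {v ∈ V | H v = θ v}`. -/
def wt (θ : ℂ) : Submodule ℂ V where
  carrier := {v | gen Gen.H • v = θ • v}
  add_mem' := by
    intro a b ha hb
    simp only [Set.mem_ofPred_eq] at *
    rw [smul_add, smul_add, ha, hb]
  zero_mem' := by simp
  smul_mem' := by
    intro c a ha
    simp only [Set.mem_ofPred_eq] at *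
    rw [smul_comm θ c a, ← ha, ← algebraMap_smul U c a, ← mul_smul, ← Algebra.commutes, mul_smul,
      algebraMap_smul]

theorem gen_smul_wt (θ : ℂ) (g : Gen) (k : ℤ) (v : V) (hv : v ∈ wt V (θ + 2 * k)) :
    gen g • v ∈ wt V (θ + 2 * ((k + deg g : ℤ) : ℂ)) := by
  change gen Gen.H • v = _ • v at hv
  change gen Gen.H • (gen g • v) = _ • (gen g • v)
  have key : gen Gen.H * gen g - gen g * gen Gen.H = (2 * (deg g : ℂ)) • gen g := by
    cases g
    · rw [gen_HE]; congr 1; simp [deg]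
    · rw [gen_HF]; congr 1; simp [deg]
    · simp [deg]
  have key2 : gen g • ((θ + 2 * (k : ℂ)) • v) = (θ + 2 * (k : ℂ)) • (gen g • v) := by
    rw [← algebraMap_smul U (θ + 2 * (k : ℂ)) v, ← mul_smul (gen g), ← Algebra.commutes,
      mul_smul, algebraMap_smul]
  rw [← mul_smul, sub_eq_iff_eq_add.1 key, add_smul, mul_smul (gen g), hv, key2, smul_assoc,
    ← add_smul]
  congr 1
  push_cast
  ring

variable (V) in
/-- The `U(sl₂)_e`-submodule `⨁_{i ∈ ℤ} V(θ - 4i)` of a `U(sl₂)`-module `V`. -/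
def wtSum (θ : ℂ) : Submodule Ue V where
  carrier := (⨆ i : ℤ, wt V (θ - 4 * i) : Submodule ℂ V)
  add_mem' := fun ha hb => add_mem ha hb
  zero_mem' := zero_mem _
  smul_mem' := by
    rintro ⟨u, hu⟩ v hv
    change v ∈ ⨆ i : ℤ, wt V (θ - 4 * i) at hv
    change u • v ∈ ⨆ i : ℤ, wt V (θ - 4 * i)
    induction hv using Submodule.iSup_induction' with
    | mem i v hv =>
      refine Ue_smul_mem (fun k : ℤ => wt V (θ + 2 * (k : ℂ))) (gen_smul_wt θ)
        (k := -2 * i) (fun n => ?_) hu (v := v) ?_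
      · refine le_trans (le_of_eq ?_) (le_iSup (fun i : ℤ => wt V (θ - 4 * i)) (i - n))
        congr 1
        push_cast
        ring
      · convert hv using 2
        push_cast
        ring
    | zero => simp
    | add a b _ _ ha hb => rw [smul_add]; exact add_mem ha hb

end modules

/-! ### The modules `L_n`, `L_n^{(0)}`, `L_n^{(1)}` -/

/-- The underlying space of the `(n+1)`-dimensional `U(sl₂)`-module `L_n`. -/
def L (n : ℕ) : Type := Fin (n + 1) →₀ ℂ

instance (n : ℕ) : AddCommGroup (L n) := inferInstanceAs (AddCommGroup (Fin (n + 1) →₀ ℂ))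
instance (n : ℕ) : Module ℂ (L n) := inferInstanceAs (Module ℂ (Fin (n + 1) →₀ ℂ))

/-- The standard basis of `L_n`. -/
def basisL (n : ℕ) : Module.Basis (Fin (n + 1)) ℂ (L n) :=
  ⟨LinearEquiv.refl ℂ (Fin (n + 1) →₀ ℂ)⟩

/-- The basis vector `v_i` of `L_n` for `0 ≤ i ≤ n`, and `0` for `i > n`. -/
def vec (n i : ℕ) : L n :=
  if h : i < n + 1 then basisL n ⟨i, h⟩ else 0

/-- The endomorphism of `L_n` sending `v_i` to `φ i` for `0 ≤ i ≤ n`. -/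
def mkL (n : ℕ) (φ : ℕ → L n) : Module.End ℂ (L n) :=
  (basisL n).constr ℂ (fun i : Fin (n + 1) => φ i)

theorem mkL_vec {n : ℕ} (φ : ℕ → L n) {i : ℕ} (hi : i ≤ n) : mkL n φ (vec n i) = φ i := by
  have h : i < n + 1 := by omega
  rw [vec, dif_pos h]
  simp [mkL]

theorem vec_eq_zero {n i : ℕ} (hi : n < i) : vec n i = 0 := by
  rw [vec, dif_neg (by omega)]

theorem L_hom_ext {n : ℕ} {f g : Module.End ℂ (L n)}
    (h : ∀ i ≤ n, f (vec n i) = g (vec n i)) : f = g := by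
  refine (basisL n).ext fun i => ?_
  have := h i (by omega)
  rwa [vec, dif_pos i.2] at this

/-- `E v_i = (n-i+1) v_{i-1}` for `1 ≤ i ≤ n` and `E v_0 = 0`. -/
def LE (n : ℕ) : Module.End ℂ (L n) :=
  mkL n (fun i => if i = 0 then 0 else ((n : ℂ) - i + 1) • vec n (i - 1))

/-- `F v_i = (i+1) v_{i+1}` for `0 ≤ i ≤ n-1` and `F v_n = 0`. -/
def LF (n : ℕ) : Module.End ℂ (L n) :=
  mkL n (fun i => ((i : ℂ) + 1) • vec n (i + 1))

/-- `H v_i = (n-2i) v_i` for `0 ≤ i ≤ n`. -/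
def LH (n : ℕ) : Module.End ℂ (L n) :=
  mkL n (fun i => ((n : ℂ) - 2 * i) • vec n i)

theorem LE_zero (n : ℕ) : LE n (vec n 0) = 0 := by
  simp [LE, mkL_vec]

theorem LE_succ {n i : ℕ} (hi : i + 1 ≤ n) :
    LE n (vec n (i + 1)) = ((n : ℂ) - i) • vec n i := by
  rw [LE, mkL_vec _ hi, if_neg (Nat.succ_ne_zero i), Nat.add_sub_cancel]
  congr 1
  push_cast
  ring

theorem LF_vec {n i : ℕ} (hi : i ≤ n) :
    LF n (vec n i) = ((i : ℂ) + 1) • vec n (i + 1) := mkL_vec _ hi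

theorem LH_vec {n i : ℕ} (hi : i ≤ n) :
    LH n (vec n i) = ((n : ℂ) - 2 * i) • vec n i := mkL_vec _ hi

/-- The action of `U(sl₂)` on `L_n`. -/
def repL (n : ℕ) : U →ₐ[ℂ] Module.End ℂ (L n) :=
  liftU (LE n) (LF n) (LH n)
    (by
      refine L_hom_ext fun i hi => ?_
      rcases i with _ | i
      · simp [LE_zero, LH_vec]
      · simp only [LinearMap.sub_apply, Module.End.mul_apply, LinearMap.smul_apply, LE_succ hi,
          LH_vec hi, map_smul, LH_vec (show i ≤ n by omega), smul_smul, ← sub_smul]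
        congr 1
        push_cast
        ring)
    (by
      refine L_hom_ext fun i hi => ?_
      simp only [LinearMap.sub_apply, Module.End.mul_apply, LinearMap.smul_apply, LF_vec hi,
          LH_vec hi, map_smul]
      rcases Nat.lt_or_ge i n with h | h
      · rw [LH_vec (show i + 1 ≤ n by omega)]
        simp only [smul_smul, ← sub_smul]
        congr 1
        push_cast
        ring
      · simp [vec_eq_zero (show n < i + 1 by omega)])
    (by
      refine L_hom_ext fun i hi => ?_
      have h1 : LE n (LF n (vec n i)) = (((i : ℂ) + 1) * ((n : ℂ) - i)) • vec n i := by
        rw [LF_vec hi, map_smul]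
        rcases Nat.lt_or_ge i n with h | h
        · rw [LE_succ h, smul_smul]
        · obtain rfl : i = n := by omega
          simp [vec_eq_zero (show i < i + 1 by omega)]
      have h2 : LF n (LE n (vec n i)) = (((n : ℂ) - i + 1) * i) • vec n i := by
        rcases i with _ | i
        · simp [LE_zero]
        · rw [LE_succ hi, map_smul, LF_vec (by omega), smul_smul]
          congr 1
          push_cast
          ring
      simp only [LinearMap.sub_apply, Module.End.mul_apply, h1, h2, LH_vec hi, ← sub_smul]
      congr 1
      ring)

instance (n : ℕ) : Module U (L n) := Module.compHom (L n) (repL n).toRingHom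

theorem smul_L {n : ℕ} (u : U) (v : L n) : u • v = repL n u v := rfl

instance (n : ℕ) : IsScalarTower ℂ U (L n) :=
  ⟨fun c u v => by simp [smul_L]⟩

/-- `L_n^{(0)} = ⨁_{i ∈ ℤ} L_n(n - 4i)`, a `U(sl₂)_e`-submodule of `L_n`. -/
def L0 (n : ℕ) : Submodule Ue (L n) := wtSum (L n) (n : ℂ)

/-- `L_n^{(1)} = ⨁_{i ∈ ℤ} L_n(n - 4i - 2)`, a `U(sl₂)_e`-submodule of `L_n` (for `n ≥ 1`). -/
def L1 (n : ℕ) : Submodule Ue (L n) := wtSum (L n) ((n : ℂ) - 2)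

/-! ### The hypercube, its halved graph and the modules on them -/

/-- The vertex set `{0,1}^D` of the hypercube `H(D,2)`. -/
abbrev X (D : ℕ) : Type := Fin D → Fin 2

/-- The set `X_e` of the vertices with even coordinate sum. -/
def Xe (D : ℕ) : Set (X D) := {y | Even (∑ i, (y i : ℕ))}

/-- The space `ℂ^X`, to be equipped with the `U(sl₂)`-module structure determined by `x`. -/
def CX {D : ℕ} (_x : X D) : Type := X D →₀ ℂ

instance {D : ℕ} (x : X D) : AddCommGroup (CX x) := inferInstanceAs (AddCommGroup (X D →₀ ℂ))
instance {D : ℕ} (x : X D) : Module ℂ (CX x) := inferInstanceAs (Module ℂ (X D →₀ ℂ))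

/-- The vertices as a basis of `ℂ^X`. -/
def basisX {D : ℕ} (x : X D) : Module.Basis (X D) ℂ (CX x) :=
  ⟨LinearEquiv.refl ℂ (X D →₀ ℂ)⟩

/-- The vertex `y` as a vector of `ℂ^X`. -/
def vtx {D : ℕ} (x y : X D) : CX x := basisX x y

/-- The endomorphism of `ℂ^X` sending each vertex `y` to `φ y`. -/
def mkX {D : ℕ} {x : X D} (φ : X D → CX x) : Module.End ℂ (CX x) := (basisX x).constr ℂ φ

theorem mkX_vtx {D : ℕ} {x : X D} (φ : X D → CX x) (y : X D) : mkX φ (vtx x y) = φ y := by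
  simp [mkX, vtx]

/-- The adjacency operator `A y = ∑_{∂(y,z)=1} z` on `ℂ^X`; the distance `∂` of `H(D,2)` is
the Hamming distance. (`x` only names the copy of `ℂ^X`.) -/
def adj {D : ℕ} (x : X D) : Module.End ℂ (CX x) :=
  mkX (fun y => ∑ z with hammingDist y z = 1, vtx x z)

/-- The dual adjacency operator `A*(x) y = (D - 2∂(x,y)) y` on `ℂ^X`. -/
def dualAdj {D : ℕ} (x : X D) : Module.End ℂ (CX x) :=
  mkX (fun y => ((D : ℂ) - 2 * (hammingDist x y : ℂ)) • vtx x y)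

/-- Change the `i`-th coordinate. -/
def flip {D : ℕ} (i : Fin D) (y : X D) : X D := Function.update y i (y i + 1)

/-- The operator on `ℂ^X` changing the `i`-th coordinate. -/
def flipOp {D : ℕ} (x : X D) (i : Fin D) : Module.End ℂ (CX x) :=
  mkX (fun y => vtx x (flip i y))

/-- The diagonal operator on `ℂ^X` with `y ↦ y` if `x_i = y_i` and `y ↦ -y` otherwise. -/
def signOp {D : ℕ} (x : X D) (i : Fin D) : Module.End ℂ (CX x) :=
  mkX (fun y => (if x i = y i then (1 : ℂ) else -1) • vtx x y)

theorem flipOp_vtx {D : ℕ} (x : X D) (i : Fin D) (y : X D) :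
    flipOp x i (vtx x y) = vtx x (flip i y) := mkX_vtx _ _

theorem signOp_vtx {D : ℕ} (x : X D) (i : Fin D) (y : X D) :
    signOp x i (vtx x y) = (if x i = y i then (1 : ℂ) else -1) • vtx x y := mkX_vtx _ _

theorem fin2_add_one_ne (a : Fin 2) : a + 1 ≠ a := by revert a; decide

theorem fin2_eq_add_one (a b : Fin 2) (h : a ≠ b) : b = a + 1 := by
  revert a b; decide

theorem flip_injective {D : ℕ} (y : X D) : Function.Injective (fun i => flip i y) := by
  intro i j h
  by_contra hij
  have := congrFun h i
  simp [flip, Function.update_of_ne hij] at this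

theorem hammingDist_eq_one_iff {D : ℕ} (y z : X D) :
    hammingDist y z = 1 ↔ ∃ i, flip i y = z := by
  rw [hammingDist, Finset.card_eq_one]
  refine exists_congr fun i => ⟨fun h => ?_, ?_⟩
  · funext j
    have hj := Finset.ext_iff.1 h j
    simp only [Finset.mem_filter, Finset.mem_univ, true_and, Finset.mem_singleton] at hj
    by_cases hji : j = i
    · subst hji
      simpa [flip] using (fin2_eq_add_one _ _ (hj.2 rfl)).symm
    · rw [flip, Function.update_of_ne hji]
      by_contra hne
      exact hji (hj.1 hne)
  · rintro rfl
    ext j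
    simp only [Finset.mem_filter, Finset.mem_univ, true_and, Finset.mem_singleton]
    by_cases hji : j = i
    · subst hji
      simp [flip]
    · simp [flip, hji]

theorem adj_vtx {D : ℕ} (x y : X D) : adj x (vtx x y) = ∑ i, vtx x (flip i y) := by
  have h : (Finset.univ.filter fun z : X D => hammingDist y z = 1)
      = Finset.univ.image (fun i => flip i y) := by
    ext z
    simp [hammingDist_eq_one_iff]
  rw [adj, mkX_vtx, h, Finset.sum_image (fun i _ j _ hij => flip_injective y hij)]

theorem dualAdj_vtx {D : ℕ} (x y : X D) :
    dualAdj x (vtx x y) = ((D : ℂ) - 2 * (hammingDist x y : ℂ)) • vtx x y := mkX_vtx _ _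

theorem CX_hom_ext {D : ℕ} {x : X D} {f g : Module.End ℂ (CX x)}
    (h : ∀ y, f (vtx x y) = g (vtx x y)) : f = g :=
  (basisX x).ext h

theorem adj_eq {D : ℕ} (x : X D) : adj x = ∑ i, flipOp x i :=
  CX_hom_ext fun y => by simp [adj_vtx, flipOp_vtx]

theorem dualAdj_eq {D : ℕ} (x : X D) : dualAdj x = ∑ i, signOp x i :=
  CX_hom_ext fun y => by
    simp only [dualAdj_vtx, LinearMap.sum_apply, signOp_vtx, ← Finset.sum_smul]
    congr 1
    have h : ∀ i, (if x i = y i then (1 : ℂ) else -1) = 1 - 2 * (if x i ≠ y i then 1 else 0) := by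
      intro i
      by_cases hi : x i = y i
      · simp [hi]
      · simp [hi]; norm_num
    simp only [h, Finset.sum_sub_distrib, ← Finset.mul_sum, hammingDist, Finset.sum_boole]
    simp

theorem flip_flip {D : ℕ} (i : Fin D) (y : X D) : flip i (flip i y) = y := by
  funext j
  by_cases hji : j = i
  · subst hji
    have : ∀ a : Fin 2, a + 1 + 1 = a := by decide
    simp [flip, this]
  · simp [flip, Function.update_of_ne hji]

theorem flip_comm {D : ℕ} (i j : Fin D) (y : X D) : flip i (flip j y) = flip j (flip i y) := by
  by_cases h : i = j
  · subst h; rfl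
  · simp only [flip, Function.update_of_ne h, Function.update_of_ne (Ne.symm h)]
    rw [Function.update_comm h]

theorem flipOp_sq {D : ℕ} (x : X D) (i : Fin D) : flipOp x i * flipOp x i = 1 :=
  CX_hom_ext fun y => by simp [flipOp_vtx, flip_flip]

theorem flipOp_comm {D : ℕ} (x : X D) (i j : Fin D) : flipOp x i * flipOp x j = flipOp x j * flipOp x i :=
  CX_hom_ext fun y => by simp [flipOp_vtx, flip_comm i j]

theorem signOp_sq {D : ℕ} (x : X D) (i : Fin D) : signOp x i * signOp x i = 1 :=
  CX_hom_ext fun y => by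
    by_cases h : x i = y i <;> simp [signOp_vtx, h]

theorem signOp_comm {D : ℕ} (x : X D) (i j : Fin D) :
    signOp x i * signOp x j = signOp x j * signOp x i :=
  CX_hom_ext fun y => by
    simp only [Module.End.mul_apply, signOp_vtx, map_smul, smul_smul]
    rw [mul_comm]

theorem flipOp_signOp_ne {D : ℕ} (x : X D) {i j : Fin D} (h : i ≠ j) :
    flipOp x i * signOp x j = signOp x j * flipOp x i :=
  CX_hom_ext fun y => by
    simp only [Module.End.mul_apply, signOp_vtx, map_smul, flipOp_vtx]
    simp [flip, Function.update_of_ne h.symm]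

theorem signOp_flipOp {D : ℕ} (x : X D) (i : Fin D) :
    signOp x i * flipOp x i = - (flipOp x i * signOp x i) :=
  CX_hom_ext fun y => by
    simp only [Module.End.mul_apply, signOp_vtx, map_smul, flipOp_vtx, LinearMap.neg_apply]
    have h : ∀ a b : Fin 2, a = b + 1 ↔ ¬ a = b := by decide
    by_cases hi : x i = y i <;> simp [flip, h, hi]

/-- `[A, A*(x)]`. -/
theorem adj_comm_dualAdj {D : ℕ} (x : X D) :
    adj x * dualAdj x - dualAdj x * adj x = (2 : ℂ) • ∑ i, flipOp x i * signOp x i := by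
  rw [adj_eq, dualAdj_eq, Finset.sum_mul_sum, Finset.sum_mul_sum, Finset.sum_comm,
    ← Finset.sum_sub_distrib, Finset.smul_sum]
  refine Finset.sum_congr rfl fun i _ => ?_
  rw [← Finset.sum_sub_distrib, Finset.sum_eq_single i]
  · rw [signOp_flipOp, two_smul, sub_neg_eq_add]
  · intro j _ hj
    rw [flipOp_signOp_ne x hj, sub_self]
  · simp

theorem dualAdj_comm_comm {D : ℕ} (x : X D) :
    dualAdj x * (adj x * dualAdj x - dualAdj x * adj x)
      - (adj x * dualAdj x - dualAdj x * adj x) * dualAdj x = (-4 : ℂ) • adj x := by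
  rw [adj_comm_dualAdj, adj_eq, dualAdj_eq, mul_smul_comm, smul_mul_assoc, ← smul_sub,
    Finset.sum_mul_sum, Finset.sum_mul_sum, Finset.sum_comm,
    ← Finset.sum_sub_distrib, Finset.smul_sum, Finset.smul_sum]
  refine Finset.sum_congr rfl fun i _ => ?_
  rw [← Finset.sum_sub_distrib, Finset.sum_eq_single i]
  · rw [← mul_assoc, signOp_flipOp, neg_mul, mul_assoc, signOp_sq, mul_one]
    module
  · intro j _ hj
    rw [← mul_assoc, ← flipOp_signOp_ne x hj.symm, mul_assoc, signOp_comm x j i, mul_assoc,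
      sub_self]
  · simp

theorem adj_comm_comm {D : ℕ} (x : X D) :
    adj x * (adj x * dualAdj x - dualAdj x * adj x)
      - (adj x * dualAdj x - dualAdj x * adj x) * adj x = (4 : ℂ) • dualAdj x := by
  rw [adj_comm_dualAdj, adj_eq, dualAdj_eq, mul_smul_comm, smul_mul_assoc, ← smul_sub,
    Finset.sum_mul_sum, Finset.sum_mul_sum, Finset.sum_comm,
    ← Finset.sum_sub_distrib, Finset.smul_sum, Finset.smul_sum]
  refine Finset.sum_congr rfl fun i _ => ?_
  rw [← Finset.sum_sub_distrib, Finset.sum_eq_single i]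
  · rw [← mul_assoc, flipOp_sq, one_mul, mul_assoc, signOp_flipOp, mul_neg, ← mul_assoc,
      flipOp_sq, one_mul]
    module
  · intro j _ hj
    rw [← mul_assoc, flipOp_comm x j i, mul_assoc, flipOp_signOp_ne x hj, mul_assoc, sub_self]
  · simp

/-- The image `A/2 - [A, A*(x)]/4` of `E`. -/
def opE {D : ℕ} (x : X D) : Module.End ℂ (CX x) :=
  (1 / 2 : ℂ) • adj x - (1 / 4 : ℂ) • (adj x * dualAdj x - dualAdj x * adj x)

/-- The image `A/2 + [A, A*(x)]/4` of `F`. -/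
def opF {D : ℕ} (x : X D) : Module.End ℂ (CX x) :=
  (1 / 2 : ℂ) • adj x + (1 / 4 : ℂ) • (adj x * dualAdj x - dualAdj x * adj x)

/-- The algebra homomorphism `ρ(x) : U(sl₂) → End(ℂ^X)` with
`E ↦ A/2 - [A,A*(x)]/4`, `F ↦ A/2 + [A,A*(x)]/4`, `H ↦ A*(x)`. Its values lie in the
subalgebra generated by `A` and `A*(x)`, the Terwilliger algebra of `H(D,2)`. -/
def rho {D : ℕ} (x : X D) : U →ₐ[ℂ] Module.End ℂ (CX x) :=
  liftU (opE x) (opF x) (dualAdj x)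
    (by
      have h := dualAdj_comm_comm x
      unfold opE
      generalize hK : adj x * dualAdj x - dualAdj x * adj x = K at *
      rw [mul_sub, sub_mul, mul_smul_comm, mul_smul_comm, smul_mul_assoc, smul_mul_assoc]
      linear_combination (norm := module) (-1 / 2 : ℂ) • hK - (1 / 4 : ℂ) • h)
    (by
      have h := dualAdj_comm_comm x
      unfold opF
      generalize hK : adj x * dualAdj x - dualAdj x * adj x = K at *
      rw [mul_add, add_mul, mul_smul_comm, mul_smul_comm, smul_mul_assoc, smul_mul_assoc]
      linear_combination (norm := module) (-1 / 2 : ℂ) • hK + (1 / 4 : ℂ) • h)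
    (by
      have h := adj_comm_comm x
      unfold opE opF
      generalize hK : adj x * dualAdj x - dualAdj x * adj x = K at *
      simp only [mul_add, add_mul, mul_sub, sub_mul, mul_smul_comm, smul_mul_assoc]
      linear_combination (norm := module) (1 / 4 : ℂ) • h)

/-- `U(sl₂)` acts on `ℂ^X(x)` through `ρ(x)`. -/
instance {D : ℕ} (x : X D) : Module U (CX x) :=
  Module.compHom (CX x) (rho x).toRingHom

theorem smul_CX {D : ℕ} {x : X D} (u : U) (v : CX x) : u • v = rho x u v := rfl

instance {D : ℕ} (x : X D) : IsScalarTower ℂ U (CX x) :=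
  ⟨fun c u v => by simp [smul_CX]⟩

/-- The span of the vertices whose coordinate sum is congruent to `k` modulo `2`. -/
def parity {D : ℕ} (x : X D) (k : ℤ) : Submodule ℂ (CX x) :=
  Submodule.span ℂ (vtx x '' {y | Even (((∑ i, (y i : ℕ) : ℕ) : ℤ) - k)})

theorem flip_parity {D : ℕ} (i : Fin D) (y : X D) (k : ℤ) :
    Even (((∑ j, (flip i y j : ℕ) : ℕ) : ℤ) - k) ↔
      ¬ Even (((∑ j, (y j : ℕ) : ℕ) : ℤ) - k) := by
  have h1 := Finset.add_sum_erase Finset.univ (fun j => (y j : ℕ)) (Finset.mem_univ i)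
  have h2 := Finset.add_sum_erase Finset.univ (fun j => (flip i y j : ℕ)) (Finset.mem_univ i)
  have h3 : ∑ j ∈ Finset.univ.erase i, (flip i y j : ℕ)
      = ∑ j ∈ Finset.univ.erase i, (y j : ℕ) :=
    Finset.sum_congr rfl fun j hj => by
      rw [flip, Function.update_of_ne (Finset.ne_of_mem_erase hj)]
  have h4 : (flip i y i : ℕ) = 1 - (y i : ℕ) := by
    have : ∀ a : Fin 2, ((a + 1 : Fin 2) : ℕ) = 1 - (a : ℕ) := by decide
    rw [flip, Function.update_self, this]
  have h5 : (y i : ℕ) < 2 := (y i).2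
  rw [Int.even_iff, Int.even_iff]
  omega

theorem adj_parity {D : ℕ} {x : X D} {k l : ℤ} (hkl : ¬ Even (k - l)) {v : CX x}
    (hv : v ∈ parity x k) : adj x v ∈ parity x l := by
  refine (Submodule.span_le.2 ?_ : parity x k ≤ (parity x l).comap (adj x)) hv
  rintro _ ⟨y, hy, rfl⟩
  change adj x (vtx x y) ∈ parity x l
  rw [adj_vtx]
  refine Submodule.sum_mem _ fun i _ => Submodule.subset_span ⟨_, ?_, rfl⟩
  change Even _
  rw [flip_parity]
  change Even _ at hy
  rw [Int.even_iff] at *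
  omega

theorem dualAdj_parity {D : ℕ} {x : X D} {k : ℤ} {v : CX x}
    (hv : v ∈ parity x k) : dualAdj x v ∈ parity x k := by
  refine (Submodule.span_le.2 ?_ : parity x k ≤ (parity x k).comap (dualAdj x)) hv
  rintro _ ⟨y, hy, rfl⟩
  change dualAdj x (vtx x y) ∈ parity x k
  rw [dualAdj_vtx]
  exact Submodule.smul_mem _ _ (Submodule.subset_span ⟨_, hy, rfl⟩)

theorem comm_parity {D : ℕ} {x : X D} {k l : ℤ} (hkl : ¬ Even (k - l)) {v : CX x}
    (hv : v ∈ parity x k) : (adj x * dualAdj x - dualAdj x * adj x) v ∈ parity x l :=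
  Submodule.sub_mem _ (adj_parity hkl (dualAdj_parity hv)) (dualAdj_parity (adj_parity hkl hv))

theorem gen_smul_parity {D : ℕ} (x : X D) (g : Gen) (k : ℤ) (v : CX x) (hv : v ∈ parity x k) :
    gen g • v ∈ parity x (k + deg g) := by
  rw [smul_CX]
  cases g
  · have hkl : ¬ Even (k - (k + deg Gen.E)) := by
      rw [Int.even_iff]; simp only [deg]; omega
    rw [rho, liftU_E]
    exact Submodule.sub_mem _ (Submodule.smul_mem _ _ (adj_parity hkl hv))
      (Submodule.smul_mem _ _ (comm_parity hkl hv))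
  · have hkl : ¬ Even (k - (k + deg Gen.F)) := by
      rw [Int.even_iff]; simp only [deg]; omega
    rw [rho, liftU_F]
    exact Submodule.add_mem _ (Submodule.smul_mem _ _ (adj_parity hkl hv))
      (Submodule.smul_mem _ _ (comm_parity hkl hv))
  · rw [rho, liftU_H]
    simpa [deg] using dualAdj_parity hv

/-- The `U(sl₂)_e`-module `ℂ^{X_e}(x)`: the subspace of `ℂ^X` spanned by `X_e`, on which
`u ∈ U(sl₂)_e` acts as the restriction of `ρ(x)(u)`. -/
def CXe {D : ℕ} (x : X D) : Submodule Ue (CX x) where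
  carrier := (Submodule.span ℂ (vtx x '' Xe D) : Submodule ℂ (CX x))
  add_mem' := fun ha hb => add_mem ha hb
  zero_mem' := zero_mem _
  smul_mem' := by
    have h0 : Submodule.span ℂ (vtx x '' Xe D) = parity x 0 := by
      simp only [parity, Xe, sub_zero, Int.even_coe_nat]
    rintro ⟨u, hu⟩ v hv
    rw [h0] at hv ⊢
    change u • v ∈ parity x 0
    refine Ue_smul_mem (parity x) (gen_smul_parity x) (k := 0) (fun n => le_of_eq ?_) hu hv
    have : ∀ a : ℤ, Even (a - (0 + 2 * n)) ↔ Even (a - 0) := by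
      intro a
      rw [Int.even_iff, Int.even_iff]
      omega
    simp only [parity, this]

/-- The multiplicity `(D-2k+1)/(D-k+1) * C(D,k)`, a natural number for `0 ≤ k ≤ D/2` (the
division is exact and nothing is truncated, see `mult_cast`). -/
def mult (D k : ℕ) : ℕ := (D - 2 * k + 1) * D.choose k / (D - k + 1)

theorem mult_cast {D k : ℕ} (hk : k ≤ D / 2) :
    (mult D k : ℚ) = ((D : ℚ) - 2 * k + 1) / ((D : ℚ) - k + 1) * (D.choose k : ℚ) := by
  have hk2 : 2 * k ≤ D := by omega
  have hdvd : (D - k + 1) ∣ (D - 2 * k + 1) * D.choose k := by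
    rcases k with _ | k
    · simp
    · have h1 := Nat.choose_succ_right_eq D k
      have h2 : D - 2 * (k + 1) + 1 = (D - (k + 1) + 1) - (k + 1) := by omega
      rw [h2, Nat.sub_mul]
      refine Nat.dvd_sub (Dvd.intro _ rfl) ?_
      rw [mul_comm (k + 1), h1]
      exact Dvd.intro_left _ (by congr 1; omega)
  have hpos : ((D - k + 1 : ℕ) : ℚ) ≠ 0 := by positivity
  have e1 : ((D - k + 1 : ℕ) : ℚ) = (D : ℚ) - k + 1 := by
    rw [Nat.cast_add, Nat.cast_sub (by omega), Nat.cast_one]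
  have e2 : ((D - 2 * k + 1 : ℕ) : ℚ) = (D : ℚ) - 2 * k + 1 := by
    rw [Nat.cast_add, Nat.cast_sub hk2]
    push_cast
    ring
  rw [mult, Nat.cast_div hdvd hpos, Nat.cast_mul, e1, e2]
  ring

end HalvedCube

end

/-!
The space `ℂ^X(x)` is decomposed as a `U(sl₂)`-module, and the decomposition is then restricted to
the even part.

The weight space of `ℂ^X(x)` of weight `D - 2j` is spanned by the vertices at distance `j` from
`x`, so it has dimension `D.choose j` (`finrank_wt_CX`). If `v` has positive weight and `EF v = 0`,
then `FE v` is a negative multiple of `v`, and the same holds, with a larger factor, for all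
`E ^ i v`; as `E` is nilpotent, `v = 0` (`eq_zero_of_EF_smul_eq_zero`). By finite-dimensionality
`EF` is bijective on the weight spaces of positive weight, and likewise `FE` on those of negative
weight. This has three consequences:

* for `2k ≤ D` the operator `E` maps the space of weight `D - 2k` onto that of weight
  `D - 2k + 2`, so the highest weight vectors of weight `D - 2k` form a space of dimension
  `D.choose k - D.choose (k - 1)`, which is `mult D k` (`finrank_highestWeight`);
* a highest weight vector `w` of weight `n` satisfies `F ^ (n + 1) w = 0`, so `v_i ↦ F ^ i w / i!`
  is a homomorphism `L_n → ℂ^X(x)` (`ofHighestWeight`);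
* the images of these homomorphisms span `ℂ^X(x)` (`wt_le_range`).

The resulting map from the direct sum of `mult D k` copies of `L_{D - 2k}` is injective because
`E` is nilpotent and the map is injective on the highest weight vectors, which in `L_n` are the
multiples of `v_0` (`fromIsotypicSum_injective`). This gives `isotypicEquiv`.

For even `x` the subspace `ℂ^{X_e}` is the sum of the weight spaces of weight `D - 4i`
(`CXe_eq_wtSum`), a description that every `U(sl₂)`-isomorphism respects. The summand `L_{D - 2k}`
contributes `L_{D - 2k}^{(0)}` for `k` even and `L_{D - 2k}^{(1)}` for `k` odd; the latter vanishes
when `D = 2k`.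
-/

noncomputable section

namespace HalvedCube

/-! ### Generalities on `U(sl₂)`-modules -/

theorem gen_EF : gen Gen.E * gen Gen.F - gen Gen.F * gen Gen.E = gen Gen.H := by
  simpa [gen] using RingQuot.mkAlgHom_rel ℂ Rel.EF

theorem gen_induction {p : U → Prop} (hc : ∀ c : ℂ, p (algebraMap ℂ U c))
    (hg : ∀ g, p (gen g)) (hmul : ∀ a b, p a → p b → p (a * b))
    (hadd : ∀ a b, p a → p b → p (a + b)) (u : U) : p u := by
  obtain ⟨a, rfl⟩ := RingQuot.mkAlgHom_surjective ℂ Rel u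
  induction a using FreeAlgebra.induction with
  | grade0 r => rw [AlgHom.commutes]; exact hc r
  | grade1 g => exact hg g
  | mul a b ha hb => rw [map_mul]; exact hmul _ _ ha hb
  | add a b ha hb => rw [map_add]; exact hadd _ _ ha hb

section modules

variable {V W : Type*} [AddCommGroup V] [Module ℂ V] [Module U V] [IsScalarTower ℂ U V]
  [AddCommGroup W] [Module ℂ W] [Module U W] [IsScalarTower ℂ U W]

/-- A `ℂ`-linear map that commutes with the three generators, as a `U(sl₂)`-linear map. -/
def homOfGen (f : V →ₗ[ℂ] W) (h : ∀ g v, f (gen g • v) = gen g • f v) : V →ₗ[U] W where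
  toFun := f
  map_add' := map_add f
  map_smul' u := by
    refine gen_induction (p := fun u => ∀ v, f (u • v) = u • f v) ?_ h ?_ ?_ u
    · intro c v
      rw [algebraMap_smul, algebraMap_smul, map_smul]
    · intro a b ha hb v
      rw [mul_smul, mul_smul, ha, hb]
    · intro a b ha hb v
      rw [add_smul, add_smul, map_add, ha, hb]

theorem map_smul_complex (f : V →ₗ[U] W) (c : ℂ) (v : V) : f (c • v) = c • f v := by
  rw [← algebraMap_smul U c v, map_smul, algebraMap_smul]

theorem mem_wt {θ : ℂ} {v : V} : v ∈ wt V θ ↔ gen Gen.H • v = θ • v := Iff.rfl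

theorem E_smul_F_smul {V : Type*} [AddCommGroup V] [Module U V] (v : V) :
    gen Gen.E • gen Gen.F • v = gen Gen.F • gen Gen.E • v + gen Gen.H • v := by
  rw [← gen_EF, sub_smul, mul_smul, mul_smul]
  abel

theorem E_smul_mem_wt {θ : ℂ} {v : V} (hv : v ∈ wt V θ) : gen Gen.E • v ∈ wt V (θ + 2) := by
  have := gen_smul_wt θ Gen.E 0 v (by simpa using hv)
  simpa [deg] using this

theorem F_smul_mem_wt {θ : ℂ} {v : V} (hv : v ∈ wt V θ) : gen Gen.F • v ∈ wt V (θ - 2) := by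
  have := gen_smul_wt θ Gen.F 0 v (by simpa using hv)
  simpa [deg, sub_eq_add_neg] using this

theorem E_pow_smul_mem_wt {θ : ℂ} {v : V} (hv : v ∈ wt V θ) (i : ℕ) :
    gen Gen.E ^ i • v ∈ wt V (θ + 2 * i) := by
  induction i with
  | zero => simpa using hv
  | succ i ih =>
    rw [pow_succ', mul_smul]
    convert E_smul_mem_wt ih using 2
    push_cast
    ring

theorem F_pow_smul_mem_wt {θ : ℂ} {v : V} (hv : v ∈ wt V θ) (i : ℕ) :
    gen Gen.F ^ i • v ∈ wt V (θ - 2 * i) := by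
  induction i with
  | zero => simpa using hv
  | succ i ih =>
    rw [pow_succ', mul_smul]
    convert F_smul_mem_wt ih using 2
    push_cast
    ring

theorem map_mem_wt (f : V →ₗ[U] W) {θ : ℂ} {v : V} (hv : v ∈ wt V θ) : f v ∈ wt W θ := by
  rw [mem_wt] at *
  rw [← map_smul, hv, map_smul_complex]

theorem mem_wtSum {θ : ℂ} {v : V} :
    v ∈ wtSum V θ ↔ v ∈ (⨆ i : ℤ, wt V (θ - 4 * i) : Submodule ℂ V) := Iff.rfl

theorem map_mem_wtSum (f : V →ₗ[U] W) {θ : ℂ} {v : V} (hv : v ∈ wtSum V θ) :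
    f v ∈ wtSum W θ := by
  rw [mem_wtSum] at *
  induction hv using Submodule.iSup_induction' with
  | mem i v hv => exact Submodule.mem_iSup_of_mem i (map_mem_wt f hv)
  | zero => simp
  | add a b _ _ ha hb => rw [map_add]; exact add_mem ha hb

/-- `wtSum V θ` depends on `θ` only modulo `4`. -/
theorem wtSum_congr {θ θ' : ℂ} (m : ℤ) (h : θ = θ' - 4 * m) : wtSum V θ = wtSum V θ' := by
  ext v
  rw [mem_wtSum, mem_wtSum,
    ← Equiv.iSup_comp (g := fun i : ℤ => wt V (θ' - 4 * i)) (Equiv.addLeft m)]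
  simp only [h, Equiv.coe_addLeft]
  push_cast
  simp only [mul_add, sub_sub]

/-- A `U(sl₂)`-isomorphism restricts to an isomorphism of the submodules `wtSum`. -/
def wtSumEquiv (f : V ≃ₗ[U] W) (θ : ℂ) :
    wtSum V θ ≃ₗ[Ue] wtSum W θ where
  toFun v := ⟨f v, map_mem_wtSum f.toLinearMap v.2⟩
  invFun w := ⟨f.symm w, map_mem_wtSum f.symm.toLinearMap w.2⟩
  map_add' _ _ := Subtype.ext (map_add f _ _)
  map_smul' u v := Subtype.ext (map_smul f (u : U) (v : V))
  left_inv _ := Subtype.ext (f.symm_apply_apply _)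
  right_inv _ := Subtype.ext (f.apply_symm_apply _)

/-! ### Nilpotency of `E` and `F` -/

/-- If `v` has weight `m` and `FE v = -c v` with `c > 0`, then `E v` has weight `m + 2` and
`FE (E v) = -(c + m + 2) E v`; so if `v ≠ 0`, all `E ^ i v` are nonzero. -/
theorem eq_zero_of_FE_smul_eq_neg (N : ℕ) : ∀ (m c : ℕ) (v : V), v ∈ wt V (m : ℂ) → 0 < c →
    gen Gen.F • gen Gen.E • v = -(c : ℂ) • v → gen Gen.E ^ N • v = 0 → v = 0 := by
  induction N with
  | zero => intro m c v _ _ _ h; simpa using h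
  | succ N ih =>
    intro m c v hv hc h hN
    have hE : gen Gen.E • v ∈ wt V ((m + 2 : ℕ) : ℂ) := by
      simpa using E_smul_mem_wt hv
    have h0 : gen Gen.E • v = 0 := by
      refine ih (m + 2) (c + m + 2) _ hE (by omega) ?_ (by rwa [← mul_smul, ← pow_succ])
      rw [← sub_eq_iff_eq_add.2 (E_smul_F_smul (gen Gen.E • v)), h, mem_wt.1 hE, smul_comm]
      generalize gen Gen.E • v = w
      push_cast
      module
    rw [h0, smul_zero, eq_comm] at h
    simpa [hc.ne'] using h

/-- If `v` has weight `-m` and `EF v = -c v` with `c > 0`, then `F v` has weight `-m - 2` and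
`EF (F v) = -(c + m + 2) F v`; so if `v ≠ 0`, all `F ^ i v` are nonzero. -/
theorem eq_zero_of_EF_smul_eq_neg (N : ℕ) : ∀ (m c : ℕ) (v : V), v ∈ wt V (-m : ℂ) → 0 < c →
    gen Gen.E • gen Gen.F • v = -(c : ℂ) • v → gen Gen.F ^ N • v = 0 → v = 0 := by
  induction N with
  | zero => intro m c v _ _ _ h; simpa using h
  | succ N ih =>
    intro m c v hv hc h hN
    have hF : gen Gen.F • v ∈ wt V (-((m + 2 : ℕ) : ℂ)) := by
      convert F_smul_mem_wt hv using 2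
      push_cast
      ring
    have h0 : gen Gen.F • v = 0 := by
      refine ih (m + 2) (c + m + 2) _ hF (by omega) ?_ (by rwa [← mul_smul, ← pow_succ])
      rw [E_smul_F_smul (gen Gen.F • v), h, mem_wt.1 hF, smul_comm]
      generalize gen Gen.F • v = w
      push_cast
      module
    rw [h0, smul_zero, eq_comm] at h
    simpa [hc.ne'] using h

/-- `EF` is injective on a space of positive weight on which `E` is nilpotent. -/
theorem eq_zero_of_EF_smul_eq_zero {m : ℕ} (hm : 0 < m) {v : V} (hv : v ∈ wt V (m : ℂ)) {N : ℕ}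
    (hN : gen Gen.E ^ N • v = 0) (h : gen Gen.E • gen Gen.F • v = 0) : v = 0 := by
  refine eq_zero_of_FE_smul_eq_neg N m m v hv hm ?_ hN
  rw [E_smul_F_smul, mem_wt.1 hv] at h
  rw [neg_smul]
  exact eq_neg_of_add_eq_zero_left h

/-- `FE` is injective on a space of negative weight on which `F` is nilpotent. -/
theorem eq_zero_of_FE_smul_eq_zero {m : ℕ} (hm : 0 < m) {v : V} (hv : v ∈ wt V (-m : ℂ)) {N : ℕ}
    (hN : gen Gen.F ^ N • v = 0) (h : gen Gen.F • gen Gen.E • v = 0) : v = 0 := by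
  refine eq_zero_of_EF_smul_eq_neg N m m v hv hm ?_ hN
  rw [E_smul_F_smul, mem_wt.1 hv, h, zero_add]

/-- A `U(sl₂)`-linear map on a module with nilpotent action of `E` is injective if it is
injective on highest weight vectors: any nonzero `v` in the kernel has a last nonzero `E ^ i v`,
which lies in the kernel and is annihilated by `E`. -/
theorem eq_zero_of_E_pow_smul_eq_zero {V W : Type*} [AddCommGroup V] [Module U V]
    [AddCommGroup W] [Module U W] {f : V →ₗ[U] W}
    (hf : ∀ v, gen Gen.E • v = 0 → f v = 0 → v = 0) (N : ℕ) :
    ∀ v, gen Gen.E ^ N • v = 0 → f v = 0 → v = 0 := by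
  induction N with
  | zero => intro v h _; simpa using h
  | succ N ih =>
    intro v h hv
    refine hf v (ih _ ?_ ?_) hv
    · rwa [← mul_smul, ← pow_succ]
    · rw [map_smul, hv, smul_zero]

theorem E_smul_F_pow_smul {θ : ℂ} {w : V} (hw : w ∈ wt V θ) (hE : gen Gen.E • w = 0) (i : ℕ) :
    gen Gen.E • gen Gen.F ^ (i + 1) • w = (((i : ℂ) + 1) * (θ - i)) • gen Gen.F ^ i • w := by
  induction i with
  | zero => simp [E_smul_F_smul, hE, mem_wt.1 hw]
  | succ i ih =>
    rw [pow_succ' _ (i + 1), mul_smul, E_smul_F_smul, ih, mem_wt.1 (F_pow_smul_mem_wt hw (i + 1)),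
      smul_comm, ← mul_smul (gen Gen.F), ← pow_succ', ← add_smul]
    congr 1
    push_cast
    ring

/-! ### Highest weight vectors and the modules `L_n` -/

theorem E_smul_vec_zero (n : ℕ) : gen Gen.E • vec n 0 = 0 := by
  rw [smul_L, repL, liftU_E, LE_zero]

theorem E_smul_vec_succ {n i : ℕ} (hi : i + 1 ≤ n) :
    gen Gen.E • vec n (i + 1) = ((n : ℂ) - i) • vec n i := by
  rw [smul_L, repL, liftU_E, LE_succ hi]

theorem F_smul_vec {n i : ℕ} (hi : i ≤ n) :
    gen Gen.F • vec n i = ((i : ℂ) + 1) • vec n (i + 1) := by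
  rw [smul_L, repL, liftU_F, LF_vec hi]

theorem H_smul_vec {n i : ℕ} (hi : i ≤ n) :
    gen Gen.H • vec n i = ((n : ℂ) - 2 * i) • vec n i := by
  rw [smul_L, repL, liftU_H, LH_vec hi]

theorem L_linearMap_ext {V : Type*} [AddCommGroup V] [Module ℂ V] {n : ℕ}
    {f g : L n →ₗ[ℂ] V} (h : ∀ i ≤ n, f (vec n i) = g (vec n i)) :
    f = g := by
  refine (basisL n).ext fun i => ?_
  have := h i (by omega)
  rwa [vec, dif_pos i.2] at this

/-- The linear map `L_n → V` with `v_i ↦ F ^ i w / i!`. -/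
def ofHighestWeightLinear (n : ℕ) (w : V) : L n →ₗ[ℂ] V :=
  (basisL n).constr ℂ fun i : Fin (n + 1) => ((i : ℕ).factorial : ℂ)⁻¹ • gen Gen.F ^ (i : ℕ) • w

theorem ofHighestWeightLinear_vec {V : Type*} [AddCommGroup V] [Module ℂ V] [Module U V]
    {n i : ℕ} (w : V) (hi : i ≤ n) :
    ofHighestWeightLinear n w (vec n i) = (i.factorial : ℂ)⁻¹ • gen Gen.F ^ i • w := by
  rw [vec, dif_pos (by omega)]
  simp [ofHighestWeightLinear]

/-- The `U(sl₂)`-linear map `L_n → V` with `v_0 ↦ w`, for a highest weight vector `w` of weight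
`n` with `F ^ (n + 1) w = 0`. -/
def ofHighestWeight {n : ℕ} {w : V} (hw : w ∈ wt V (n : ℂ)) (hE : gen Gen.E • w = 0)
    (hF : gen Gen.F ^ (n + 1) • w = 0) : L n →ₗ[U] V :=
  homOfGen (ofHighestWeightLinear n w) (by
    intro g
    refine fun v => LinearMap.congr_fun (f := ofHighestWeightLinear n w ∘ₗ
      DistribSMul.toLinearMap ℂ (L n) (gen g)) (g := DistribSMul.toLinearMap ℂ V (gen g) ∘ₗ
      ofHighestWeightLinear n w) (L_linearMap_ext fun i hi => ?_) v
    simp only [LinearMap.comp_apply, DistribSMul.toLinearMap_apply]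
    have hfac : ((i.factorial : ℕ) : ℂ) ≠ 0 := Nat.cast_ne_zero.2 i.factorial_ne_zero
    have hi1 : (i : ℂ) + 1 ≠ 0 := Nat.cast_add_one_ne_zero i
    rw [ofHighestWeightLinear_vec w hi, smul_comm]
    cases g
    · rcases i with _ | i
      · simp [E_smul_vec_zero, hE]
      · rw [E_smul_vec_succ hi, map_smul, ofHighestWeightLinear_vec w (by omega),
          E_smul_F_pow_smul hw hE, smul_smul, smul_smul]
        congr 1
        have hi0 : (i : ℂ) + 1 ≠ 0 := Nat.cast_add_one_ne_zero i
        have hfac0 : ((i.factorial : ℕ) : ℂ) ≠ 0 := Nat.cast_ne_zero.2 i.factorial_ne_zero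
        rw [Nat.factorial_succ]
        push_cast
        field_simp
    · rw [F_smul_vec hi, map_smul, ← mul_smul, ← pow_succ']
      rcases hi.lt_or_eq with h | rfl
      · rw [ofHighestWeightLinear_vec w (by omega), smul_smul, Nat.factorial_succ]
        congr 1
        push_cast
        field_simp
      · rw [vec_eq_zero (by omega), map_zero, smul_zero, hF, smul_zero]
    · rw [H_smul_vec hi, map_smul, ofHighestWeightLinear_vec w hi,
        mem_wt.1 (F_pow_smul_mem_wt hw i), smul_comm])

theorem ofHighestWeight_vec_zero {n : ℕ} {w : V} (hw : w ∈ wt V (n : ℂ))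
    (hE : gen Gen.E • w = 0) (hF : gen Gen.F ^ (n + 1) • w = 0) :
    ofHighestWeight hw hE hF (vec n 0) = w := by
  refine (ofHighestWeightLinear_vec w (Nat.zero_le n)).trans ?_
  simp

end modules

theorem E_pow_smul_L {n : ℕ} (u : L n) {N : ℕ} (hN : n < N) : gen Gen.E ^ N • u = 0 := by
  have h : ∀ N i : ℕ, i < N → gen Gen.E ^ N • vec n i = 0 := by
    intro N
    induction N with
    | zero => intro i hi; omega
    | succ N ih =>
      intro i hi
      rcases Nat.lt_or_ge n i with hni | hni
      · rw [vec_eq_zero hni, smul_zero]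
      · rw [pow_succ, mul_smul]
        rcases i with _ | i
        · rw [E_smul_vec_zero, smul_zero]
        · rw [E_smul_vec_succ hni, smul_comm, ih i (by omega), smul_zero]
  exact LinearMap.congr_fun (f := DistribSMul.toLinearMap ℂ (L n) (gen Gen.E ^ N)) (g := 0)
    (L_linearMap_ext fun i hi => h N i (by omega)) u

theorem basisL_repr_E_smul {n : ℕ} (u : L n) (i : Fin n) :
    (basisL n).repr (gen Gen.E • u) i.castSucc
      = ((n : ℂ) - (i : ℕ)) * (basisL n).repr u i.succ := by
  refine LinearMap.congr_fun (f := (basisL n).coord i.castSucc ∘ₗ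
    DistribSMul.toLinearMap ℂ (L n) (gen Gen.E)) (g := ((n : ℂ) - (i : ℕ)) •
    (basisL n).coord i.succ) (L_linearMap_ext fun j hj => ?_) u
  simp only [LinearMap.comp_apply, DistribSMul.toLinearMap_apply, LinearMap.smul_apply]
  rcases j with _ | j
  · rw [E_smul_vec_zero, vec, dif_pos (by omega)]
    simp [Fin.ext_iff]
  · rw [E_smul_vec_succ hj, vec, vec, dif_pos (by omega), dif_pos (by omega)]
    by_cases h : j = (i : ℕ) <;> simp [Finsupp.single_apply, Fin.ext_iff, h]

/-- The highest weight vectors of `L_n` are the multiples of `v_0`. -/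
theorem eq_smul_vec_zero {n : ℕ} {u : L n} (hu : gen Gen.E • u = 0) :
    u = (basisL n).repr u 0 • vec n 0 := by
  refine (basisL n).ext_elem fun i => ?_
  rw [vec, dif_pos (by omega)]
  refine Fin.cases ?_ (fun i => ?_) i
  · simp
  · have h := basisL_repr_E_smul u i
    have hi : (n : ℂ) - (i : ℕ) ≠ 0 := by
      rw [sub_ne_zero]
      exact_mod_cast i.2.ne'
    rw [hu, map_zero, Finsupp.zero_apply, eq_comm, mul_eq_zero, or_iff_right hi] at h
    simp [h, Fin.ext_iff]

/-! ### Weight spaces of the hypercube module -/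

section cube

variable {D : ℕ} {x : X D}

theorem H_smul_vtx (y : X D) :
    gen Gen.H • vtx x y = ((D : ℂ) - 2 * (hammingDist x y : ℂ)) • vtx x y := by
  rw [smul_CX, rho, liftU_H, dualAdj_vtx]

theorem vtx_mem_wt (y : X D) : vtx x y ∈ wt (CX x) ((D : ℂ) - 2 * (hammingDist x y : ℂ)) :=
  H_smul_vtx y

theorem basisX_repr_H_smul (v : CX x) (y : X D) :
    (basisX x).repr (gen Gen.H • v) y
      = ((D : ℂ) - 2 * (hammingDist x y : ℂ)) * (basisX x).repr v y := by
  refine LinearMap.congr_fun (f := (basisX x).coord y ∘ₗ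
    DistribSMul.toLinearMap ℂ (CX x) (gen Gen.H)) (g := ((D : ℂ) - 2 * (hammingDist x y : ℂ)) •
    (basisX x).coord y) ((basisX x).ext fun z => ?_) v
  change (basisX x).repr (gen Gen.H • vtx x z) y = _ * (basisX x).repr (vtx x z) y
  rw [H_smul_vtx, vtx]
  by_cases h : z = y <;> simp [h]

theorem wt_CX (θ : ℂ) :
    wt (CX x) θ = Submodule.span ℂ (vtx x '' {y | (D : ℂ) - 2 * (hammingDist x y : ℂ) = θ}) := by
  refine le_antisymm (fun v hv => ?_) (Submodule.span_le.2 ?_)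
  · refine (Module.Basis.mem_span_image (basisX x)).2 fun y hy => ?_
    have h := basisX_repr_H_smul v y
    rw [mem_wt.1 hv, map_smul, Finsupp.smul_apply, smul_eq_mul] at h
    exact (mul_right_cancel₀ (Finsupp.mem_support_iff.1 hy) h).symm
  · rintro _ ⟨y, rfl, rfl⟩
    exact vtx_mem_wt y

theorem wt_CX_eq_bot {θ : ℂ} (h : ∀ d : ℕ, d ≤ D → (D : ℂ) - 2 * (d : ℂ) ≠ θ) :
    wt (CX x) θ = ⊥ := by
  have hempty : {y : X D | (D : ℂ) - 2 * (hammingDist x y : ℂ) = θ} = ∅ :=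
    Set.eq_empty_of_forall_notMem fun y hy =>
      h _ (by simpa using hammingDist_le_card_fintype (x := x) (y := y)) hy
  rw [wt_CX, hempty, Set.image_empty, Submodule.span_empty]

theorem card_hammingDist_eq (x : X D) (j : ℕ) :
    (Finset.univ.filter fun y : X D => hammingDist x y = j).card = D.choose j := by
  have hcard : D.choose j = (Finset.powersetCard j (Finset.univ : Finset (Fin D))).card := by
    simp
  rw [hcard]
  have h2 : ∀ a : Fin 2, a ≠ a + 1 := by decide
  refine Finset.card_nbij' (fun y => Finset.univ.filter fun i => x i ≠ y i)
    (fun S i => if i ∈ S then x i + 1 else x i) ?_ ?_ ?_ ?_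
  · intro y hy
    simpa [hammingDist] using hy
  · intro S hS
    have hS' : S.card = j := by simpa using hS
    have : (Finset.univ.filter fun i => x i ≠ if i ∈ S then x i + 1 else x i) = S := by
      ext i
      by_cases h : i ∈ S <;> simp [h, h2]
    simpa [hammingDist, this] using hS'
  · intro y _
    funext i
    by_cases h : x i = y i
    · simp [h]
    · simpa [h] using (fin2_eq_add_one _ _ h).symm
  · intro S _
    ext i
    by_cases h : i ∈ S <;> simp [h, h2]

theorem finrank_wt_CX (j : ℕ) :
    Module.finrank ℂ (wt (CX x) ((D : ℂ) - 2 * j)) = D.choose j := by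
  have hset : {y : X D | (D : ℂ) - 2 * (hammingDist x y : ℂ) = (D : ℂ) - 2 * j}
      = {y | hammingDist x y = j} := by
    ext y
    simp
  rw [wt_CX, hset, Set.image_eq_range]
  have hli : LinearIndependent ℂ fun y : {y : X D | hammingDist x y = j} => vtx x y :=
    (basisX x).linearIndependent.comp _ Subtype.val_injective
  rw [finrank_span_eq_card hli, ← card_hammingDist_eq x j, Fintype.card_subtype]
  rfl

instance : FiniteDimensional ℂ (CX x) := (basisX x).finiteDimensional_of_finite

theorem E_pow_smul_CX {j : ℕ} {v : CX x} (hv : v ∈ wt (CX x) ((D : ℂ) - 2 * j)) :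
    gen Gen.E ^ (j + 1) • v = 0 := by
  have h := E_pow_smul_mem_wt hv (j + 1)
  rwa [wt_CX_eq_bot, Submodule.mem_bot] at h
  intro d _ h
  have : ((2 + 2 * d : ℕ) : ℂ) = (0 : ℕ) := by
    push_cast at h ⊢
    linear_combination -h
  have := Nat.cast_injective this
  omega

theorem F_pow_smul_CX {j : ℕ} {v : CX x} (hv : v ∈ wt (CX x) ((D : ℂ) - 2 * j)) :
    gen Gen.F ^ (D + 1) • v = 0 := by
  have h := F_pow_smul_mem_wt hv (D + 1)
  rwa [wt_CX_eq_bot, Submodule.mem_bot] at h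
  intro d hd h
  have : ((d : ℕ) : ℂ) = (j + (D + 1) : ℕ) := by
    push_cast at h ⊢
    linear_combination -(1 / 2 : ℂ) * h
  have := Nat.cast_injective this
  omega

theorem E_smul_mem_wt_CX {j : ℕ} {v : CX x} (hv : v ∈ wt (CX x) ((D : ℂ) - 2 * (j + 1 : ℕ))) :
    gen Gen.E • v ∈ wt (CX x) ((D : ℂ) - 2 * j) := by
  convert E_smul_mem_wt hv using 2
  push_cast
  ring

theorem F_smul_mem_wt_CX {j : ℕ} {v : CX x} (hv : v ∈ wt (CX x) ((D : ℂ) - 2 * j)) :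
    gen Gen.F • v ∈ wt (CX x) ((D : ℂ) - 2 * (j + 1 : ℕ)) := by
  convert F_smul_mem_wt hv using 2
  push_cast
  ring

/-- On the weight spaces of positive weight `EF` is bijective. -/
theorem exists_EF_smul_eq {j : ℕ} (hj : 2 * j < D) {v : CX x}
    (hv : v ∈ wt (CX x) ((D : ℂ) - 2 * j)) :
    ∃ u ∈ wt (CX x) ((D : ℂ) - 2 * j), gen Gen.E • gen Gen.F • u = v := by
  let f : wt (CX x) ((D : ℂ) - 2 * j) →ₗ[ℂ] wt (CX x) ((D : ℂ) - 2 * j) :=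
    LinearMap.restrict (DistribSMul.toLinearMap ℂ (CX x) (gen Gen.E) ∘ₗ
      DistribSMul.toLinearMap ℂ (CX x) (gen Gen.F))
      fun v hv => E_smul_mem_wt_CX (F_smul_mem_wt_CX hv)
  have hf : Function.Injective f := by
    refine (injective_iff_map_eq_zero f).2 fun u hu => Subtype.ext ?_
    refine eq_zero_of_EF_smul_eq_zero (m := D - 2 * j) (by omega) ?_ (E_pow_smul_CX u.2)
      (congrArg Subtype.val hu)
    have := u.2
    rwa [Nat.cast_sub hj.le, Nat.cast_mul, Nat.cast_ofNat]
  obtain ⟨u, hu⟩ := LinearMap.injective_iff_surjective.1 hf ⟨v, hv⟩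
  exact ⟨u, u.2, congrArg Subtype.val hu⟩

theorem eq_zero_of_FE_smul_CX {j : ℕ} (hj : D < 2 * j) {v : CX x}
    (hv : v ∈ wt (CX x) ((D : ℂ) - 2 * j)) (h : gen Gen.F • gen Gen.E • v = 0) : v = 0 := by
  refine eq_zero_of_FE_smul_eq_zero (m := 2 * j - D) (by omega) ?_ (F_pow_smul_CX hv) h
  convert hv using 2
  rw [Nat.cast_sub hj.le]
  push_cast
  ring

/-- On the weight spaces of negative weight `FE` is bijective. -/
theorem exists_FE_smul_eq {j : ℕ} (hj : D < 2 * (j + 1)) {v : CX x}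
    (hv : v ∈ wt (CX x) ((D : ℂ) - 2 * (j + 1 : ℕ))) :
    ∃ u ∈ wt (CX x) ((D : ℂ) - 2 * (j + 1 : ℕ)), gen Gen.F • gen Gen.E • u = v := by
  let f : wt (CX x) ((D : ℂ) - 2 * (j + 1 : ℕ)) →ₗ[ℂ] wt (CX x) ((D : ℂ) - 2 * (j + 1 : ℕ)) :=
    LinearMap.restrict (DistribSMul.toLinearMap ℂ (CX x) (gen Gen.F) ∘ₗ
      DistribSMul.toLinearMap ℂ (CX x) (gen Gen.E))
      fun v hv => F_smul_mem_wt_CX (E_smul_mem_wt_CX hv)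
  have hf : Function.Injective f :=
    (injective_iff_map_eq_zero f).2 fun u hu =>
      Subtype.ext (eq_zero_of_FE_smul_CX hj u.2 (congrArg Subtype.val hu))
  obtain ⟨u, hu⟩ := LinearMap.injective_iff_surjective.1 hf ⟨v, hv⟩
  exact ⟨u, u.2, congrArg Subtype.val hu⟩

/-! ### Highest weight vectors of the hypercube module -/

variable (x) in
/-- The space of highest weight vectors of weight `D - 2k` in `ℂ^X(x)`. -/
def highestWeight (k : ℕ) : Submodule ℂ (CX x) :=
  wt (CX x) ((D : ℂ) - 2 * k) ⊓ LinearMap.ker (DistribSMul.toLinearMap ℂ (CX x) (gen Gen.E))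

theorem mem_highestWeight {k : ℕ} {v : CX x} :
    v ∈ highestWeight x k ↔ v ∈ wt (CX x) ((D : ℂ) - 2 * k) ∧ gen Gen.E • v = 0 := Iff.rfl

theorem mult_zero (D : ℕ) : mult D 0 = 1 := by
  simp [mult]

theorem mult_succ {D k : ℕ} (hk : 2 * (k + 1) ≤ D) :
    mult D (k + 1) + D.choose k = D.choose (k + 1) := by
  have h1 := Nat.choose_succ_right_eq D k
  have h2 : D - 2 * (k + 1) + 1 = (D - k) - (k + 1) := by omega
  have h3 : D - (k + 1) + 1 = D - k := by omega
  have hle : D.choose k ≤ D.choose (k + 1) := by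
    refine Nat.le_of_mul_le_mul_right (?_ : _ * (k + 1) ≤ _) (Nat.succ_pos k)
    rw [h1]
    exact Nat.mul_le_mul_left _ (by omega)
  have h4 : (D - 2 * (k + 1) + 1) * D.choose (k + 1)
      = (D - k) * (D.choose (k + 1) - D.choose k) := by
    rw [h2, Nat.sub_mul, Nat.mul_sub, mul_comm (k + 1), h1, mul_comm (D.choose k)]
  rw [mult, h3, h4, Nat.mul_div_cancel_left _ (by omega)]
  omega

theorem finrank_highestWeight {k : ℕ} (hk : 2 * k ≤ D) :
    Module.finrank ℂ (highestWeight x k) = mult D k := by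
  rcases k with _ | k
  · have h : highestWeight x 0 = wt (CX x) ((D : ℂ) - 2 * (0 : ℕ)) :=
      inf_eq_left.2 fun v hv => by simpa using E_pow_smul_CX hv
    rw [h, finrank_wt_CX, mult_zero, Nat.choose_zero_right]
  · let f : wt (CX x) ((D : ℂ) - 2 * (k + 1 : ℕ)) →ₗ[ℂ] wt (CX x) ((D : ℂ) - 2 * k) :=
      LinearMap.restrict (DistribSMul.toLinearMap ℂ (CX x) (gen Gen.E))
        fun v hv => E_smul_mem_wt_CX hv
    have hf : Function.Surjective f := by
      rintro ⟨v, hv⟩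
      obtain ⟨u, hu, huv⟩ := exists_EF_smul_eq (by omega) hv
      exact ⟨⟨_, F_smul_mem_wt_CX hu⟩, Subtype.ext huv⟩
    have hker : (LinearMap.ker f).map (Submodule.subtype _) = highestWeight x (k + 1) := by
      ext v
      simp only [Submodule.mem_map, LinearMap.mem_ker, mem_highestWeight]
      constructor
      · rintro ⟨u, hu, rfl⟩
        exact ⟨u.2, congrArg Subtype.val hu⟩
      · rintro ⟨hv, hE⟩
        exact ⟨⟨v, hv⟩, Subtype.ext hE, rfl⟩
    have hrn := LinearMap.finrank_range_add_finrank_ker f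
    rw [LinearMap.range_eq_top.2 hf, finrank_top, finrank_wt_CX, finrank_wt_CX] at hrn
    rw [← hker, (Submodule.equivMapOfInjective _ Subtype.val_injective _).finrank_eq.symm]
    have := mult_succ hk
    omega

theorem F_pow_smul_highestWeight {k : ℕ} (hk : 2 * k ≤ D) {w : CX x}
    (hw : w ∈ highestWeight x k) : gen Gen.F ^ (D - 2 * k + 1) • w = 0 := by
  obtain ⟨hw, hE⟩ := mem_highestWeight.1 hw
  have hwt := F_pow_smul_mem_wt hw (D - 2 * k + 1)
  refine eq_zero_of_FE_smul_CX (j := k + (D - 2 * k + 1)) (by omega) ?_ ?_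
  · convert hwt using 2
    push_cast
    ring
  · rw [E_smul_F_pow_smul hw hE, Nat.cast_sub hk]
    push_cast
    simp

variable (x) in
/-- A basis of the space of highest weight vectors of weight `D - 2k`. -/
def highestWeightBasis {k : ℕ} (hk : 2 * k ≤ D) :
    Module.Basis (Fin (mult D k)) ℂ (highestWeight x k) :=
  Module.finBasisOfFinrankEq ℂ _ (finrank_highestWeight hk)

end cube

/-! ### The decomposition of the hypercube module -/

theorem two_mul_le_of_fin {D : ℕ} (k : Fin (D / 2 + 1)) : 2 * (k : ℕ) ≤ D := by
  have := k.2
  omega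

/-- The direct sum of `mult D k` copies of `L_{D - 2k}`, over `0 ≤ k ≤ D / 2`. -/
abbrev IsotypicSum (D : ℕ) : Type :=
  (k : Fin (D / 2 + 1)) → Fin (mult D k) → L (D - 2 * k)

section cube

variable {D : ℕ} {x : X D}

variable (x) in
/-- The embedding of `L_{D - 2k}` given by the `m`-th basic highest weight vector. -/
def component (k : Fin (D / 2 + 1)) (m : Fin (mult D k)) : L (D - 2 * k) →ₗ[U] CX x :=
  ofHighestWeight (w := (highestWeightBasis x (two_mul_le_of_fin k) m : CX x))
    (by
      rw [Nat.cast_sub (two_mul_le_of_fin k), Nat.cast_mul, Nat.cast_ofNat]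
      exact (highestWeightBasis x (two_mul_le_of_fin k) m).2.1)
    (highestWeightBasis x (two_mul_le_of_fin k) m).2.2
    (F_pow_smul_highestWeight (two_mul_le_of_fin k) (Subtype.prop _))

theorem component_vec_zero (k : Fin (D / 2 + 1)) (m : Fin (mult D k)) :
    component x k m (vec (D - 2 * k) 0) = highestWeightBasis x (two_mul_le_of_fin k) m :=
  ofHighestWeight_vec_zero _ _ _

variable (x) in
/-- The sum of all embeddings `component x k m`. -/
def fromIsotypicSum : IsotypicSum D →ₗ[U] CX x :=
  ∑ k, ∑ m, component x k m ∘ₗ LinearMap.proj m ∘ₗ LinearMap.proj k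

theorem fromIsotypicSum_apply (t : IsotypicSum D) :
    fromIsotypicSum x t = ∑ k, ∑ m, component x k m (t k m) := by
  simp [fromIsotypicSum, LinearMap.sum_apply]

/-- The weight spaces of `ℂ^X(x)` are independent. -/
theorem sum_wt_eq_zero {ι : Type*} [Fintype ι] {j : ι → ℕ} (hj : Function.Injective j)
    {u : ι → CX x} (hu : ∀ i, u i ∈ wt (CX x) ((D : ℂ) - 2 * j i)) (h : ∑ i, u i = 0) (i : ι) :
    u i = 0 := by
  have hzero : ∀ i y, hammingDist x y ≠ j i → (basisX x).repr (u i) y = 0 := by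
    intro i y hy
    have h1 := basisX_repr_H_smul (u i) y
    rw [mem_wt.1 (hu i), map_smul, Finsupp.smul_apply, smul_eq_mul, ← sub_eq_zero,
      ← sub_mul] at h1
    refine (mul_eq_zero.1 h1).resolve_left fun h2 => hy ?_
    have h3 : (hammingDist x y : ℂ) = (j i : ℂ) := by linear_combination (1 / 2 : ℂ) * h2
    exact_mod_cast h3
  refine (basisX x).ext_elem fun y => ?_
  rw [map_zero, Finsupp.zero_apply]
  by_cases hy : hammingDist x y = j i
  · have hsum := congrArg (fun v => (basisX x).repr v y) h
    simp only [map_sum, Finsupp.finsetSum_apply, map_zero, Finsupp.zero_apply] at hsum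
    rwa [Finset.sum_eq_single i (fun i' _ hi' => hzero i' y fun h' => hi' (hj (h'.symm.trans hy)))
      (by simp)] at hsum
  · exact hzero i y hy

theorem fromIsotypicSum_injective : Function.Injective (fromIsotypicSum x) := by
  refine (injective_iff_map_eq_zero _).2 fun t ht =>
    eq_zero_of_E_pow_smul_eq_zero (f := fromIsotypicSum x) (fun t hE ht => ?_) (D + 1) t ?_ ht
  · let c (k : Fin (D / 2 + 1)) (m : Fin (mult D k)) : ℂ := (basisL (D - 2 * k)).repr (t k m) 0
    have htc : ∀ (k : Fin (D / 2 + 1)) (m : Fin (mult D k)), t k m = c k m • vec (D - 2 * k) 0 := fun k m =>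
      eq_smul_vec_zero (congrFun (congrFun hE k) m)
    have hsum : ∑ k : Fin (D / 2 + 1), ((∑ m, c k m • highestWeightBasis x (two_mul_le_of_fin k) m :
        highestWeight x k) : CX x) = 0 := by
      rw [← ht, fromIsotypicSum_apply]
      refine Finset.sum_congr rfl fun k _ => ?_
      rw [AddSubmonoidClass.coe_finsetSum]
      refine Finset.sum_congr rfl fun m _ => ?_
      rw [htc, map_smul_complex, component_vec_zero, Submodule.coe_smul]
    funext k m
    have hk := sum_wt_eq_zero Fin.val_injective (fun k => (mem_highestWeight.1 (Subtype.prop _)).1) hsum k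
    have hc := Fintype.linearIndependent_iff.1
      (highestWeightBasis x (two_mul_le_of_fin k)).linearIndependent (c k) (Subtype.ext hk) m
    rw [htc, hc, zero_smul]
    rfl
  · funext k m
    exact E_pow_smul_L _ (by omega)

theorem component_mem_range (k : Fin (D / 2 + 1)) (m : Fin (mult D k)) (v : L (D - 2 * k)) :
    component x k m v ∈ LinearMap.range (fromIsotypicSum x) := by
  refine ⟨Pi.single k (Pi.single m v), ?_⟩
  rw [fromIsotypicSum_apply, Finset.sum_eq_single k, Finset.sum_eq_single m]
  · simp
  · intro m' _ hm'
    simp [hm']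
  · simp
  · intro k' _ hk'
    simp [hk']
  · simp

theorem highestWeight_le_range {k : ℕ} (hk : 2 * k ≤ D) :
    highestWeight x k ≤ (LinearMap.range (fromIsotypicSum x)).restrictScalars ℂ := by
  intro v hv
  have hv' := congrArg Subtype.val
    ((highestWeightBasis x hk).sum_repr ⟨v, hv⟩)
  rw [AddSubmonoidClass.coe_finsetSum] at hv'
  change _ = v at hv'
  rw [← hv']
  refine Submodule.sum_mem _ fun m _ => Submodule.smul_mem _ _ ?_
  have := component_vec_zero (x := x) ⟨k, by omega⟩ m
  rw [← this]
  exact component_mem_range _ _ _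

/-- Every weight vector lies in the range, by induction on `j`. Let `W` be the space of weight
`D - 2j`. If `2(j + 1) ≤ D`, a vector of weight `D - 2(j + 1)` is the sum of a vector in `F W` and
a highest weight vector; otherwise it lies in `F W`. -/
theorem wt_le_range (j : ℕ) : wt (CX x) ((D : ℂ) - 2 * j) ≤
    (LinearMap.range (fromIsotypicSum x)).restrictScalars ℂ := by
  induction j with
  | zero =>
    intro v hv
    exact highestWeight_le_range (k := 0) (by omega) ⟨hv, by simpa using E_pow_smul_CX hv⟩
  | succ j ih =>
    intro v hv
    rcases Nat.lt_or_ge D (2 * (j + 1)) with hj | hj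
    · obtain ⟨u, hu, rfl⟩ := exists_FE_smul_eq hj hv
      exact Submodule.smul_mem (LinearMap.range (fromIsotypicSum x)) _ (ih (E_smul_mem_wt_CX hu))
    · obtain ⟨u, hu, huv⟩ := exists_EF_smul_eq (by omega) (E_smul_mem_wt_CX hv)
      have h1 : gen Gen.F • u ∈ LinearMap.range (fromIsotypicSum x) :=
        Submodule.smul_mem _ _ (ih hu)
      have h2 : v - gen Gen.F • u ∈ LinearMap.range (fromIsotypicSum x) := by
        refine highestWeight_le_range hj (mem_highestWeight.2 ⟨?_, ?_⟩)
        · exact sub_mem hv (F_smul_mem_wt_CX hu)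
        · rw [smul_sub, huv, sub_self]
      simpa using add_mem h2 h1

theorem fromIsotypicSum_surjective : Function.Surjective (fromIsotypicSum x) := by
  have h : (⊤ : Submodule ℂ (CX x)) ≤
      (LinearMap.range (fromIsotypicSum x)).restrictScalars ℂ := by
    rw [← (basisX x).span_eq, Submodule.span_le]
    rintro _ ⟨y, rfl⟩
    exact wt_le_range _ (vtx_mem_wt y)
  exact fun v => h (Submodule.mem_top (x := v))

variable (x) in
/-- The isomorphism `⨁_k mult D k · L_{D - 2k} ≃ ℂ^X(x)` of `U(sl₂)`-modules. -/
def isotypicEquiv : IsotypicSum D ≃ₗ[U] CX x :=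
  LinearEquiv.ofBijective (fromIsotypicSum x)
    ⟨fromIsotypicSum_injective, fromIsotypicSum_surjective⟩

/-! ### Restriction to the even part -/

theorem even_hammingDist_add (x y : X D) :
    Even (hammingDist x y + ∑ i, (x i : ℕ) + ∑ i, (y i : ℕ)) := by
  rw [hammingDist, Finset.card_filter, ← Finset.sum_add_distrib, ← Finset.sum_add_distrib]
  refine Finset.even_sum _ fun i _ => ?_
  have : ∀ a b : Fin 2, Even ((if a ≠ b then 1 else 0) + (a : ℕ) + (b : ℕ)) := by decide
  exact this _ _

theorem mem_Xe_iff_even_hammingDist (hx : x ∈ Xe D) (y : X D) :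
    y ∈ Xe D ↔ Even (hammingDist x y) := by
  have h := even_hammingDist_add x y
  have hx' : Even (∑ i, (x i : ℕ)) := hx
  rw [Nat.even_add, Nat.even_add] at h
  change Even (∑ i, (y i : ℕ)) ↔ _
  tauto

theorem CXe_eq_wtSum (hx : x ∈ Xe D) : CXe x = wtSum (CX x) (D : ℂ) := by
  suffices h : Submodule.span ℂ (vtx x '' Xe D) = ⨆ i : ℤ, wt (CX x) ((D : ℂ) - 4 * i) from
    Submodule.ext fun v => SetLike.ext_iff.1 h v
  refine le_antisymm (Submodule.span_le.2 ?_) (iSup_le fun i => ?_)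
  · rintro _ ⟨y, hy, rfl⟩
    obtain ⟨r, hr⟩ := (mem_Xe_iff_even_hammingDist hx y).1 hy
    refine Submodule.mem_iSup_of_mem (r : ℤ) ?_
    convert vtx_mem_wt (x := x) y using 2
    rw [hr]
    push_cast
    ring
  · rw [wt_CX]
    refine Submodule.span_mono (Set.image_mono fun y hy => ?_)
    have h : ((hammingDist x y : ℤ) : ℂ) = ((2 * i : ℤ) : ℂ) := by
      have hy' : (D : ℂ) - 2 * (hammingDist x y : ℂ) = (D : ℂ) - 4 * i := hy
      push_cast
      linear_combination (-1 / 2 : ℂ) * hy'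
    have h' : (hammingDist x y : ℤ) = 2 * i := by exact_mod_cast h
    rw [mem_Xe_iff_even_hammingDist hx, Nat.even_iff]
    omega

theorem mem_wtSum_isotypicSum {θ : ℂ} {t : IsotypicSum D} :
    t ∈ wtSum (IsotypicSum D) θ ↔
      ∀ (k : Fin (D / 2 + 1)) (m : Fin (mult D k)), t k m ∈ wtSum (L (D - 2 * k)) θ := by
  refine ⟨fun h k m => map_mem_wtSum (LinearMap.proj m ∘ₗ LinearMap.proj k :
    IsotypicSum D →ₗ[U] L (D - 2 * k)) h, fun h => ?_⟩
  have ht : t = ∑ k : Fin (D / 2 + 1), ∑ m : Fin (mult D k), (LinearMap.single U _ k ∘ₗ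
      LinearMap.single U (fun _ => L (D - 2 * k)) m :
      L (D - 2 * k) →ₗ[U] IsotypicSum D) (t k m) := by
    simp only [LinearMap.comp_apply, ← map_sum]
    simp [Finset.univ_sum_single]
  rw [ht]
  exact sum_mem fun k _ => sum_mem fun m _ => map_mem_wtSum _ (h k m)

theorem L0_eq {k : ℕ} (hk : 2 * k ≤ D) (h : Even k) :
    L0 (D - 2 * k) = wtSum (L (D - 2 * k)) (D : ℂ) := by
  obtain ⟨r, rfl⟩ := h
  refine wtSum_congr (r : ℤ) ?_
  rw [Nat.cast_sub hk]
  push_cast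
  ring

theorem L1_eq {k : ℕ} (hk : 2 * k ≤ D) (h : Odd k) :
    L1 (D - 2 * k) = wtSum (L (D - 2 * k)) (D : ℂ) := by
  obtain ⟨r, rfl⟩ := h
  refine wtSum_congr (r + 1 : ℤ) ?_
  rw [Nat.cast_sub hk]
  push_cast
  ring

/-- For `D = 2k` with `k` odd the summands `L_{D - 2k} = L_0` do not meet the even part: the
only weight of `L_0` is `0`, and `D` is not divisible by `4`. -/
theorem wtSum_L_eq_bot {k n : ℕ} (hk : 2 * k = D) (h : Odd k) (hn : n = 0) :
    wtSum (L n) (D : ℂ) = ⊥ := by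
  subst hn hk
  suffices h : (⨆ i : ℤ, wt (L 0) (((2 * k : ℕ) : ℂ) - 4 * i) : Submodule ℂ (L 0)) = ⊥ from
    Submodule.ext fun v => SetLike.ext_iff.1 h v
  refine iSup_eq_bot.2 fun i => (Submodule.eq_bot_iff _).2 fun v hv => ?_
  have hH : gen Gen.H • v = 0 := by
    refine LinearMap.congr_fun (f := DistribSMul.toLinearMap ℂ (L 0) (gen Gen.H)) (g := 0)
      (L_linearMap_ext fun j hj => ?_) v
    obtain rfl : j = 0 := by omega
    simp [H_smul_vec]
  rw [mem_wt, hH, eq_comm, smul_eq_zero] at hv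
  refine hv.resolve_left fun h0 => ?_
  have h1 : ((2 * k - 4 * i : ℤ) : ℂ) = (0 : ℤ) := by
    push_cast at h0 ⊢
    exact h0
  have h2 : (2 * k - 4 * i : ℤ) = 0 := by exact_mod_cast h1
  rw [Nat.odd_iff] at h
  omega

/-- The even part of `IsotypicSum D`, as the product of the components
`L_{D - 2k}^{(0)}`, `k` even, and `L_{D - 2k}^{(1)}`, `k` odd; the zero component `k = D / 2` with
`D` even and `k` odd is omitted. -/
abbrev EvenIsotypicSum (D : ℕ) : Type :=
  ((k : {k : ℕ // Even k ∧ k ≤ D / 2}) → Fin (mult D k) → L0 (D - 2 * k)) ×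
    ((k : {k : ℕ // Odd k ∧ k ≤ (D - 1) / 2}) → Fin (mult D k) → L1 (D - 2 * k))

/-- The projection of the even part of `IsotypicSum D` to its components. -/
def toEvenIsotypicSum (D : ℕ) :
    wtSum (IsotypicSum D) (D : ℂ) →ₗ[Ue] EvenIsotypicSum D where
  toFun t :=
    (fun k m => ⟨t.1 (⟨k, by have := k.2.2; omega⟩ : Fin (D / 2 + 1)) m, by
        rw [L0_eq (by have := k.2.2; omega) k.2.1]
        exact mem_wtSum_isotypicSum.1 t.2 (⟨k, _⟩ : Fin (D / 2 + 1)) m⟩,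
      fun k m => ⟨t.1 (⟨k, by have := k.2.2; omega⟩ : Fin (D / 2 + 1)) m, by
        rw [L1_eq (by have := k.2.2; omega) k.2.1]
        exact mem_wtSum_isotypicSum.1 t.2 (⟨k, _⟩ : Fin (D / 2 + 1)) m⟩)
  map_add' _ _ := rfl
  map_smul' _ _ := rfl

theorem toEvenIsotypicSum_bijective (D : ℕ) : Function.Bijective (toEvenIsotypicSum D) := by
  constructor
  · refine fun t t' ht => Subtype.ext ?_
    funext k m
    have hk := two_mul_le_of_fin k
    rcases Nat.even_or_odd (k : ℕ) with h | h
    · exact congrArg Subtype.val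
        (congrFun (congrFun (congrArg Prod.fst ht) ⟨k, h, by omega⟩) m)
    · by_cases hkD : 2 * (k : ℕ) = D
      · have h1 := mem_wtSum_isotypicSum.1 t.2 k m
        have h2 := mem_wtSum_isotypicSum.1 t'.2 k m
        rw [wtSum_L_eq_bot hkD h (by omega), Submodule.mem_bot] at h1 h2
        exact h1.trans h2.symm
      · exact congrArg Subtype.val
          (congrFun (congrFun (congrArg Prod.snd ht) ⟨k, h, by omega⟩) m)
  · rintro ⟨a, b⟩
    classical
    let t : IsotypicSum D := fun k m =>
      if h : Even (k : ℕ) ∧ (k : ℕ) ≤ D / 2 then a ⟨k, h⟩ m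
      else if h : Odd (k : ℕ) ∧ (k : ℕ) ≤ (D - 1) / 2 then b ⟨k, h⟩ m else 0
    have ht : t ∈ wtSum (IsotypicSum D) (D : ℂ) := by
      refine mem_wtSum_isotypicSum.2 fun k m => ?_
      simp only [t]
      split_ifs with h h'
      · rw [← L0_eq (two_mul_le_of_fin k) h.1]
        exact Subtype.prop _
      · rw [← L1_eq (two_mul_le_of_fin k) h'.1]
        exact Subtype.prop _
      · exact zero_mem _
    refine ⟨⟨t, ht⟩, Prod.ext ?_ ?_⟩
    · funext k m
      exact Subtype.ext (dif_pos k.2)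
    · funext k m
      exact Subtype.ext ((dif_neg fun h => Nat.not_even_iff_odd.2 k.2.1 h.1).trans (dif_pos k.2))

end cube

end HalvedCube
end

theorem theorem6p5 (D : ℕ) (hD : 2 ≤ D) (x : HalvedCube.X D) (hx : x ∈ HalvedCube.Xe D) :
    Nonempty
      (HalvedCube.CXe x ≃ₗ[HalvedCube.Ue]
        (⨁ k : {k : ℕ // Even k ∧ k ≤ D / 2},
            ⨁ _ : Fin (HalvedCube.mult D k), HalvedCube.L0 (D - 2 * k)) ×
        (⨁ k : {k : ℕ // Odd k ∧ k ≤ (D - 1) / 2},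
            ⨁ _ : Fin (HalvedCube.mult D k), HalvedCube.L1 (D - 2 * k))) := by
  have h0 : Finite {k : ℕ // Even k ∧ k ≤ D / 2} :=
    ((Set.finite_Iic (D / 2)).subset fun _ h => h.2).to_subtype
  have h1 : Finite {k : ℕ // Odd k ∧ k ≤ (D - 1) / 2} :=
    ((Set.finite_Iic ((D - 1) / 2)).subset fun _ h => h.2).to_subtype
  have := Fintype.ofFinite {k : ℕ // Even k ∧ k ≤ D / 2}
  have := Fintype.ofFinite {k : ℕ // Odd k ∧ k ≤ (D - 1) / 2}
  have e : HalvedCube.CXe x ≃ₗ[HalvedCube.Ue] HalvedCube.EvenIsotypicSum D :=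
    LinearEquiv.ofEq _ _ (HalvedCube.CXe_eq_wtSum hx) ≪≫ₗ
      HalvedCube.wtSumEquiv (HalvedCube.isotypicEquiv x).symm (D : ℂ) ≪≫ₗ
      LinearEquiv.ofBijective _ (HalvedCube.toEvenIsotypicSum_bijective D)
  refine ⟨e ≪≫ₗ LinearEquiv.symm (LinearEquiv.prodCongr ?_ ?_)⟩
  · exact DirectSum.linearEquivFunOnFintype _ _ _ ≪≫ₗ
      LinearEquiv.piCongrRight fun k => DirectSum.linearEquivFunOnFintype _ _ _
  · exact DirectSum.linearEquivFunOnFintype _ _ _ ≪≫ₗ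
      LinearEquiv.piCongrRight fun k => DirectSum.linearEquivFunOnFintype _ _ _
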